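/- Let $P$ and $Q$ be finite nonzero measures on $\mathbb{R}^n$ with (measurable, nonnegative, real-valued) densities $f$ and $g$ with respect to a common base measure $\mu$. Assume that $\{f\neq 0\}=\{g\neq 0\}$ and that $f(x)/g(x)\le M$ for a constant $M$ and all $x$ with $g(x)\neq 0$. An exponential race with measure $Q$ is simulated by drawing, for $i=1,2,\dots$, all independently, $E_i\sim\mathrm{Exp}(Q(\mathbb{R}^n))$ and $X_i\sim Q(\cdot)/Q(\mathbb{R}^n)$, and setting $T_i=T_{i-1}+E_i$ with $T_0=0$; the arrivals are $(T_i,X_i)$. *Rejection sampling* (REJ) runs through the arrivals $(T_i,X_i)$, $i=1,2,\dots$, of a simulated race with measure $MQ$. In iteration $i$ it draws an independent $U_i\sim\mathrm{Uniform}[0,1]$ and returns $(T_i,X_i)$ if $U_i<f(X_i)/(g(X_i)M)$. *Perturbation sampling* (PER) starts with $T^*=\infty$ and runs through the arrivals $(T_i,X_i)$, $i=1,2,\dots$, of a simulated race with measure $Q$. In iteration $i$, if $T^*>T_i\,g(X_i)/f(X_i)$, it sets $T^*=T_i\,g(X_i)/f(X_i)$ and $X^*=X_i$; then it returns $(T^*,X^*)$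 if $T_{i+1}/M\ge T^*$. Let $K(\mathrm{REJ})$ and $K(\mathrm{PER})$, with values in $\{1,2,\dots\}\cup\{\infty\}$, be the number of proposals considered, that is, the index of the iteration in which the algorithm returns ($\infty$ if it never returns). Then for every integer $k\ge 0$ $$\mathbb{P}(K(\mathrm{REJ})>k)=\mathbb{P}(K(\mathrm{PER})>k)=(1-\rho)^k,\qquad \rho=\frac{P(\mathbb{R}^n)}{Q(\mathbb{R}^n)\,M}.$$ Thus $0<\rho\le 1$, and $K(\mathrm{REJ})$ and $K(\mathrm{PER})$ are geometric random variables on $\{1,2,\dots\}$ with success probability $\rho$ and $$\mathbb{E}(K(\mathrm{REJ}))=\mathbb{E}(K(\mathrm{PER}))=\frac1\rho.$$ -/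

import Mathlib

open MeasureTheory ProbabilityTheory Set
open scoped ENNReal

noncomputable section

/-- `Y 0, Y 1, …` are independent random variables, each with law `ν`. -/
def IsIIDSeq {Ω β : Type*} [MeasurableSpace Ω] [MeasurableSpace β]
    (Y : ℕ → Ω → β) (ν : Measure β) (Pr : Measure Ω) : Prop :=
  (∀ i, HasLaw (Y i) ν Pr) ∧ iIndepFun Y Pr

/-- The law of one step `(E, X)` of the simulation of an exponential race with finite nonzero
measure `Q`: the waiting time `E` has the exponential law with rate equal to the total mass of `Q`,
the location `X` has the normalized law `Q(·) / Q(univ)`, and the two are independent. -/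
def raceStepLaw {α : Type*} [MeasurableSpace α] (Q : Measure α) : Measure (ℝ × α) :=
  (expMeasure (Q.real univ)).prod ((Q univ)⁻¹ • Q)

/-- The uniform distribution on `[0, 1]`. -/
def uniform01 : Measure ℝ := volume.restrict (Icc 0 1)

/-- The `m`-th arrival time `T_m = E_1 + ⋯ + E_m` of a race (so `T_0 = 0`) whose steps are
`y 0 = (E_1, X_1)`, `y 1 = (E_2, X_2)`, … -/
def arrivalTime {α : Type*} (y : ℕ → ℝ × α) (m : ℕ) : ℝ := ∑ j ∈ Finset.range m, (y j).1

/-- The number of iterations of a loop that executes the iterations `1, 2, 3, …` and returns at the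
end of the first iteration `i + 1` for which `halt i` holds; it is `⊤` if the loop never returns. -/
def iterationCount (halt : ℕ → Prop) : ℕ∞ := ⨅ (i : ℕ) (_ : halt i), ((i : ℕ∞) + 1)

/-- The number of proposals considered by rejection sampling. Its random inputs are the steps
`((E_i, X_i), U_i)`, `i = 1, 2, …`; iteration `i` accepts `X_i` and returns if
`U_i < f(X_i) / (g(X_i) M)`. -/
def rejCount {α : Type*} (f g : α → ℝ) (M : ℝ) (y : ℕ → (ℝ × α) × ℝ) : ℕ∞ :=
  iterationCount fun i => (y i).2 < f (y i).1.2 / (g (y i).1.2 * M)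

/-- The variables `(T*, X*)` of perturbation sampling after `m` iterations: the earliest perturbed
arrival `(T_i g(X_i) / f(X_i), X_i)` among `i = 1, …, m`, starting from `(∞, null)`. -/
def perState {α : Type*} (f g : α → ℝ) (y : ℕ → ℝ × α) : ℕ → EReal × Option α
  | 0 => (⊤, none)
  | m + 1 =>
    let x := (y m).2
    let t : EReal := ((arrivalTime y (m + 1) * g x / f x : ℝ) : EReal)
    if t < (perState f g y m).1 then (t, some x) else perState f g y m

/-- The number of proposals considered by perturbation sampling. Its random inputs are the steps
`(E_i, X_i)`, `i = 1, 2, …`, of a race; iteration `i` updates `(T*, X*)` and returns if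
`T_{i+1} / M ≥ T*`. -/
def perCount {α : Type*} (f g : α → ℝ) (M : ℝ) (y : ℕ → ℝ × α) : ℕ∞ :=
  iterationCount fun i => (perState f g y (i + 1)).1 ≤ ((arrivalTime y (i + 2) / M : ℝ) : EReal)

/-- `K` is geometric with success probability `p > 0` on `{1, 2, 3, …}` (the number of trials up to
and including the first success). `geometricMeasure p` is the law of the number of failures. -/
def IsGeometric {Ω : Type*} [MeasurableSpace Ω] (K : Ω → ℕ∞) (p : unitInterval)
    (Pr : Measure Ω) : Prop :=
  0 < (p : ℝ) ∧ HasLaw K ((geometricMeasure p).map fun m : ℕ => (m : ℕ∞) + 1) Pr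

end

/-! Both algorithms are governed by the mean acceptance ratio `∫ f / (g M) dν = ρ`, where `ν` is the
normalized `Q`.

For rejection sampling the iterations are independent, and each rejects with probability `1 - ρ`.

For perturbation sampling the halting tests are dependent, but arrival times increase and `T*`
decreases. So surviving the first `k` tests is the single event that `T_{k+1} / M < T*` after `k`
iterations (`lt_perCount_iff`). Given `T_{k+1} = t`, the earlier arrivals behave like `k`
independent uniform points of `[0, t]`. Such a point, at time `s` with location `x`, is perturbed
beyond `t / M` exactly when `s > t f(x) / (g(x) M)`. Since the ratio is at most 1, averaging over
`s` and `x` gives probability `1 - ρ`, whatever `t` is (`integral_lateProb`). Hence the survival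
probability is `(1 - ρ)^k`.

The conditioning is replaced by an induction on the law of `(T_k, T*)`, tested against the weight
`exp(r T)` on `{T ≤ t, T* > c}` (`lintegral_perWeight_eq`). Multiplied by `r exp(-r t)`, this weight
is the density at `t` of the next arrival, so a Gamma density appears and integrates to 1
(`prob_next_lt`). -/

/-! ### Counting variables determined by their survival function -/

lemma lt_iterationCount_iff {halt : ℕ → Prop} {k : ℕ} :
    (k : ℕ∞) < iterationCount halt ↔ ∀ i < k, ¬ halt i := by
  rw [← ENat.add_one_le_iff (ENat.natCast_ne_top k), iterationCount]
  simp only [le_iInf_iff]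
  refine forall_congr' fun i => ?_
  have : (k : ℕ∞) + 1 ≤ (i : ℕ∞) + 1 ↔ k ≤ i := by
    rw [← Nat.cast_succ, ← Nat.cast_succ, Nat.cast_le, Nat.succ_le_succ_iff]
  rw [this, imp_not_comm, not_lt]

lemma measurable_enat_of_lt {Ω : Type*} [MeasurableSpace Ω] {K : Ω → ℕ∞}
    (h : ∀ k : ℕ, MeasurableSet {ω | (k : ℕ∞) < K ω}) : Measurable K := by
  refine ENat.measurable_iff.2 fun n => ?_
  have : K ⁻¹' {(n : ℕ∞)} = (⋂ k < n, {ω | (k : ℕ∞) < K ω}) \ {ω | (n : ℕ∞) < K ω} := by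
    ext ω
    simp only [mem_preimage, mem_singleton_iff, mem_sdiff, mem_iInter, mem_ofPred_eq, not_lt]
    constructor
    · intro h; rw [h]; exact ⟨fun i hi => by exact_mod_cast hi, le_rfl⟩
    · rintro ⟨h1, h2⟩
      refine le_antisymm h2 ?_
      rcases n with _ | n
      · simp
      · have := h1 n n.lt_succ_self
        rw [← ENat.add_one_le_iff (ENat.natCast_ne_top n)] at this
        exact_mod_cast this
  rw [this]
  exact (MeasurableSet.biInter (to_countable _) fun k _ => h k).diff (h n)

lemma ENat.toENNReal_eq_tsum_indicator (m : ℕ∞) :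
    (m : ℝ≥0∞) = ∑' k : ℕ, if (k : ℕ∞) < m then (1 : ℝ≥0∞) else 0 := by
  induction m using ENat.recTopCoe with
  | top => simp
  | coe a =>
    rw [tsum_eq_sum (s := Finset.range a)]
    · simp only [Nat.cast_lt, Finset.sum_ite]
      rw [Finset.filter_true_of_mem (by simp)]
      simp
    · intro b hb
      simpa using hb

lemma nullMeasurableSet_lt_enat {Ω : Type*} [MeasurableSpace Ω] {Pr : Measure Ω} {K : Ω → ℕ∞}
    (hK : AEMeasurable K Pr) (k : ℕ) : NullMeasurableSet {ω | (k : ℕ∞) < K ω} Pr :=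
  hK.nullMeasurable (MeasurableSet.of_discrete (s := Ioi (k : ℕ∞)))

lemma measure_eq_of_survival {Ω : Type*} [MeasurableSpace Ω] {Pr : Measure Ω}
    [IsProbabilityMeasure Pr] {K : Ω → ℕ∞} (hK : AEMeasurable K Pr) {ρ : ℝ} (hρ : ρ ∈ unitInterval)
    (hs : ∀ k : ℕ, Pr.real {ω | (k : ℕ∞) < K ω} = (1 - ρ) ^ k) (k : ℕ) :
    Pr (K ⁻¹' {(k : ℕ∞) + 1}) = ENNReal.ofReal ((1 - ρ) ^ k * ρ) := by
  have : K ⁻¹' {(k : ℕ∞) + 1} = {ω | (k : ℕ∞) < K ω} \ {ω | ((k + 1 : ℕ) : ℕ∞) < K ω} := by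
    ext ω
    simp only [mem_preimage, mem_singleton_iff, mem_sdiff, mem_ofPred_eq, not_lt]
    rw [← ENat.add_one_le_iff (ENat.natCast_ne_top k), and_comm, Nat.cast_add, Nat.cast_one,
      ← le_antisymm_iff]
  have hsub : {ω | ((k + 1 : ℕ) : ℕ∞) < K ω} ⊆ {ω | (k : ℕ∞) < K ω} := fun ω hω =>
    lt_trans (Nat.cast_lt.2 k.lt_succ_self) (mem_ofPred_eq ▸ hω)
  rw [this, measure_sdiff hsub (nullMeasurableSet_lt_enat hK _) (measure_ne_top _ _),
    ← ofReal_measureReal, ← ofReal_measureReal, hs, hs,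
    ← ENNReal.ofReal_sub _ (pow_nonneg (sub_nonneg.2 hρ.2) _)]
  congr 1
  ring

/-- Point masses are differences of consecutive survival probabilities, and the expectation is their
sum, a geometric series. -/
theorem isGeometric_and_lintegral_of_survival {Ω : Type*} [MeasurableSpace Ω] {Pr : Measure Ω}
    [IsProbabilityMeasure Pr] {K : Ω → ℕ∞} (hK : AEMeasurable K Pr) {ρ : ℝ} (hρ : ρ ∈ unitInterval)
    (h0 : 0 < ρ) (hs : ∀ k : ℕ, Pr.real {ω | (k : ℕ∞) < K ω} = (1 - ρ) ^ k) :
    IsGeometric K ⟨ρ, hρ⟩ Pr ∧ ∫⁻ ω, (K ω : ℝ≥0∞) ∂Pr = ENNReal.ofReal (1 / ρ) := by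
  have hne : (⟨ρ, hρ⟩ : unitInterval) ≠ 0 := fun h => h0.ne' (congrArg Subtype.val h)
  have hr0 : 0 ≤ 1 - ρ := sub_nonneg.2 hρ.2
  have hr1 : 1 - ρ < 1 := by linarith
  have hP : ∀ k : ℕ, Pr {ω | (k : ℕ∞) < K ω} = ENNReal.ofReal (1 - ρ) ^ k := fun k => by
    rw [← ofReal_measureReal, hs, ENNReal.ofReal_pow hr0]
  refine ⟨⟨h0, hK, ?_⟩, ?_⟩
  · refine Measure.ext_of_singleton fun m => ?_
    rw [Measure.map_apply_of_aemeasurable hK (measurableSet_singleton m),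
      Measure.map_apply (measurable_of_countable _) (measurableSet_singleton m)]
    induction m using ENat.recTopCoe with
    | top =>
      have e : (fun m : ℕ => (m : ℕ∞) + 1) ⁻¹' {⊤} = ∅ := by
        ext m
        simp only [mem_preimage, mem_singleton_iff, mem_empty_iff_false, iff_false]
        exact_mod_cast ENat.natCast_ne_top (m + 1)
      rw [e, measure_empty]
      -- Never returning lies in every survival event, whose probabilities tend to 0 because `ρ >
      -- 0`.
      have hle : ∀ k : ℕ, Pr (K ⁻¹' {⊤}) ≤ ENNReal.ofReal (1 - ρ) ^ k := fun k => by
        rw [← hP]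
        refine measure_mono fun ω hω => ?_
        rw [mem_ofPred_eq, mem_singleton_iff.1 hω]
        exact ENat.natCast_lt_top k
      exact le_antisymm (ge_of_tendsto' (ENNReal.tendsto_pow_atTop_nhds_zero_of_lt_one
        (by simpa using h0)) hle) bot_le
    | coe a =>
      rcases a with _ | k
      · have e : (fun m : ℕ => (m : ℕ∞) + 1) ⁻¹' {((0 : ℕ) : ℕ∞)} = ∅ := by
          ext m
          simp
        rw [e, measure_empty, ← nonpos_iff_eq_zero]
        have h1 := hP 0
        rw [pow_zero, ← prob_compl_eq_zero_iff₀ (nullMeasurableSet_lt_enat hK 0)] at h1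
        refine (measure_mono fun ω hω => ?_).trans h1.le
        rw [mem_compl_iff, mem_ofPred_eq, mem_singleton_iff.1 hω]
        exact lt_irrefl _
      · have e : (fun m : ℕ => (m : ℕ∞) + 1) ⁻¹' {((k + 1 : ℕ) : ℕ∞)} = {k} := by
          ext m
          simp
        rw [e, geometricMeasure_singleton hne, ← measure_eq_of_survival hK hρ hs k]
        simp
  · simp_rw [ENat.toENNReal_eq_tsum_indicator]
    have hmeas : ∀ k : ℕ, AEMeasurable (fun ω => if (k : ℕ∞) < K ω then (1 : ℝ≥0∞) else 0) Pr :=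
      fun k => (measurable_of_countable
        fun m : ℕ∞ => if (k : ℕ∞) < m then (1 : ℝ≥0∞) else 0).comp_aemeasurable hK
    rw [lintegral_tsum hmeas]
    have : ∀ k : ℕ, ∫⁻ ω, (if (k : ℕ∞) < K ω then (1 : ℝ≥0∞) else 0) ∂Pr
        = ENNReal.ofReal (1 - ρ) ^ k := fun k => by
      rw [← hP, ← lintegral_indicator_one₀ (nullMeasurableSet_lt_enat hK k)]
      simp [indicator_apply]
    simp_rw [this]
    rw [ENNReal.tsum_geometric, ← ENNReal.ofReal_one, ← ENNReal.ofReal_sub _ hr0, sub_sub_cancel,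
      ← ENNReal.ofReal_inv_of_pos h0, one_div]

/-! ### Markov step for functionals of an i.i.d. sequence -/

/-- A functional of the first `k` inputs is independent of input `k`, so their joint law is a
product. -/
lemma map_step_eq_map_prod {Ω β γ δ : Type*} [MeasurableSpace Ω] [MeasurableSpace β]
    [MeasurableSpace γ] [MeasurableSpace δ] {Pr : Measure Ω} [IsProbabilityMeasure Pr]
    {Y : ℕ → Ω → β} {ν : Measure β}
    (hY : IsIIDSeq Y ν Pr) {k : ℕ} {V : (ℕ → β) → γ} (hV : Measurable V)
    (hdep : DependsOn V (Finset.range k : Set ℕ)) {W : (ℕ → β) → δ}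
    {Φ : γ × β → δ} (hΦ : Measurable Φ) (hW : ∀ y, W y = Φ (V y, y k)) :
    Pr.map (fun ω => W fun i => Y i ω) = ((Pr.map fun ω => V fun i => Y i ω).prod ν).map Φ := by
  have hm : ∀ i, AEMeasurable (Y i) Pr := fun i => (hY.1 i).aemeasurable
  obtain ⟨ω₀⟩ : Nonempty Ω := nonempty_of_isProbabilityMeasure Pr
  -- The value `Y 0 ω₀` is only a filler for coordinates that `V` ignores.
  let φ : (Finset.range k → β) → γ := fun w =>
    V fun i => if h : i ∈ Finset.range k then w ⟨i, h⟩ else Y 0 ω₀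
  have hφ : Measurable φ := by
    refine hV.comp (measurable_pi_lambda _ fun i => ?_)
    by_cases h : i ∈ Finset.range k
    · simpa [h] using measurable_pi_apply _
    · simp [h]
  have hφV : ∀ ω, V (fun i => Y i ω) = φ fun i => Y i ω := fun ω =>
    hdep fun i hi => by
      have hi' : i ∈ Finset.range k := hi
      simp [Finset.mem_range.1 hi']
  have hind : IndepFun (fun ω => V fun i => Y i ω) (Y k) Pr := by
    have := (hY.2.indepFun_finset₀ (Finset.range k) {k} (by simp) hm).comp hφ
      (measurable_pi_apply ⟨k, Finset.mem_singleton_self k⟩)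
    simp_rw [hφV]
    exact this
  have hVm : AEMeasurable (fun ω => V fun i => Y i ω) Pr :=
    hV.comp_aemeasurable (aemeasurable_pi_lambda _ hm)
  have hl := (indepFun_iff_map_prod_eq_prod_map_map hVm (hm k)).1 hind
  rw [(hY.1 k).map_eq] at hl
  rw [← hl, AEMeasurable.map_map_of_aemeasurable hΦ.aemeasurable (hVm.prodMk (hm k))]
  congr 1
  ext1 ω
  exact hW _

/-! ### Calculus: iterated integrals and the exponential shift -/

-- The primitive of a monotone `G` need not be differentiable everywhere, but `G` has only countably
-- many discontinuities, which the fundamental theorem of calculus tolerates.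
open intervalIntegral in
lemma integral_monotone_mul_integral_pow {G : ℝ → ℝ} (hG : Monotone G) (k : ℕ) (t : ℝ) :
    ∫ s in (0 : ℝ)..t, G s * (∫ u in (0 : ℝ)..s, G u) ^ k
      = (∫ u in (0 : ℝ)..t, G u) ^ (k + 1) / (k + 1) := by
  have hint : ∀ a b, IntervalIntegrable G volume a b := fun a b => hG.intervalIntegrable
  have hcont : Continuous fun s => ∫ u in (0 : ℝ)..s, G u :=
    intervalIntegral.continuous_primitive hint 0
  have h := MeasureTheory.integral_eq_of_hasDerivAt_off_countable (a := 0) (b := t)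
    (fun s => (∫ u in (0 : ℝ)..s, G u) ^ (k + 1) / (k + 1))
    (fun s => G s * (∫ u in (0 : ℝ)..s, G u) ^ k) hG.countable_not_continuousAt
    ((hcont.pow _).div_const _).continuousOn (fun s hs => ?_)
    ((hint 0 t).mul_continuousOn (hcont.pow k).continuousOn)
  · rw [h]
    simp
  · have hc : ContinuousAt G s := not_not.1 hs.2
    have hd := integral_hasDerivAt_right (hint 0 s)
      hG.measurable.stronglyMeasurable.stronglyMeasurableAtFilter hc
    refine ((hd.pow (k + 1)).div_const ((k : ℝ) + 1)).congr_deriv ?_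
    push_cast
    field_simp

lemma lintegral_monotone_mul_integral_pow {G : ℝ → ℝ} (hG : Monotone G) (h0 : ∀ s, 0 ≤ G s)
    (k : ℕ) {t : ℝ} (ht : 0 ≤ t) :
    ∫⁻ s in Icc 0 t, ENNReal.ofReal (G s * (∫ u in (0 : ℝ)..s, G u) ^ k)
      = ENNReal.ofReal ((∫ u in (0 : ℝ)..t, G u) ^ (k + 1) / (k + 1)) := by
  have hint : ∀ a b, IntervalIntegrable G volume a b := fun a b => hG.intervalIntegrable
  have hcont : Continuous fun s => ∫ u in (0 : ℝ)..s, G u :=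
    intervalIntegral.continuous_primitive hint 0
  rw [← integral_monotone_mul_integral_pow hG k t, intervalIntegral.integral_of_le ht,
    ← integral_Icc_eq_integral_Ioc, ofReal_integral_eq_lintegral_ofReal]
  · refine (intervalIntegrable_iff_integrableOn_Icc_of_le ht (by finiteness)).1 ?_
    exact (hint 0 t).mul_continuousOn (hcont.pow k).continuousOn
  · refine (ae_restrict_iff' measurableSet_Icc).2 (ae_of_all _ fun s hs => ?_)
    exact mul_nonneg (h0 s) (pow_nonneg (intervalIntegral.integral_nonneg hs.1 fun u _ => h0 u) _)

/-- Substituting `s = T + e` confines the dependence on `T` to the factor `exp(r T)` on `{T ≤ s}`,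
the one built into `perWeight`. -/
lemma lintegral_expMeasure_add (r T : ℝ) {h : ℝ → ℝ≥0∞} (hh : Measurable h) :
    ∫⁻ e, h (T + e) ∂(expMeasure r)
      = ∫⁻ s, (if T ≤ s then ENNReal.ofReal (Real.exp (r * T)) else 0) *
          (ENNReal.ofReal (r * Real.exp (-(r * s))) * h s) := by
  have hm : Measurable (exponentialPDF r) := (measurable_exponentialPDFReal r).ennreal_ofReal
  have hexp : expMeasure r = volume.withDensity (exponentialPDF r) := rfl
  rw [hexp, lintegral_withDensity_eq_lintegral_mul _ hm
      (show Measurable fun e => h (T + e) from hh.comp (measurable_const_add T)),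
    ← lintegral_add_left_eq_self
      (fun s => (if T ≤ s then ENNReal.ofReal (Real.exp (r * T)) else 0) *
          (ENNReal.ofReal (r * Real.exp (-(r * s))) * h s)) T]
  refine lintegral_congr fun e => ?_
  rw [Pi.mul_apply, exponentialPDF_eq, ← mul_assoc]
  congr 1
  by_cases he : 0 ≤ e
  · rw [if_pos he, if_pos (by linarith), ← ENNReal.ofReal_mul (Real.exp_nonneg _), mul_left_comm,
      ← Real.exp_add]
    ring_nf
  · rw [if_neg he, if_neg (by linarith)]
    simp

/-! ### The chain of arrival time and best perturbed time -/

noncomputable section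

/-- The update `(T, T*) ↦ (T + E, min T* ((T + E) g(X) / f(X)))` of perturbation sampling. -/
def perStep {α : Type*} (f g : α → ℝ) (p : (ℝ × EReal) × (ℝ × α)) : ℝ × EReal :=
  (p.1.1 + p.2.1, min p.1.2 (((p.1.1 + p.2.1) * g p.2.2 / f p.2.2 : ℝ) : EReal))

/-- The arrival time and the best perturbed arrival time after `k` iterations. -/
def perPair {α : Type*} (f g : α → ℝ) (k : ℕ) (y : ℕ → ℝ × α) : ℝ × EReal :=
  (arrivalTime y k, (perState f g y k).1)

lemma perState_succ_fst {α : Type*} (f g : α → ℝ) (y : ℕ → ℝ × α) (k : ℕ) :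
    (perState f g y (k + 1)).1 = min (perState f g y k).1
      ((arrivalTime y (k + 1) * g (y k).2 / f (y k).2 : ℝ) : EReal) := by
  rw [perState]
  split_ifs with h
  · exact (min_eq_right h.le).symm
  · exact (min_eq_left (not_lt.1 h)).symm

lemma arrivalTime_succ {α : Type*} (y : ℕ → ℝ × α) (k : ℕ) :
    arrivalTime y (k + 1) = arrivalTime y k + (y k).1 := Finset.sum_range_succ _ _

lemma perPair_succ {α : Type*} (f g : α → ℝ) (k : ℕ) (y : ℕ → ℝ × α) :
    perPair f g (k + 1) y = perStep f g (perPair f g k y, y k) := by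
  simp only [perPair, perStep, perState_succ_fst, arrivalTime_succ]

lemma dependsOn_perPair {α : Type*} (f g : α → ℝ) (k : ℕ) :
    DependsOn (perPair f g k) (Finset.range k : Set ℕ) := by
  induction k with
  | zero => intro x y _; rfl
  | succ k ih =>
    intro x y h
    rw [perPair_succ, perPair_succ, h k (by simp), ih fun i hi => h i ?_]
    simp only [Finset.coe_range, mem_Iio] at hi ⊢
    omega

section

variable {α : Type*} [MeasurableSpace α] {f g : α → ℝ}

lemma measurable_perStep (hf : Measurable f) (hg : Measurable g) : Measurable (perStep f g) := by
  unfold perStep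
  fun_prop

lemma measurable_perPair (hf : Measurable f) (hg : Measurable g) (k : ℕ) :
    Measurable (perPair f g k) := by
  induction k with
  | zero => exact measurable_const (a := ((0 : ℝ), (⊤ : EReal)))
  | succ k ih =>
    simp_rw [funext (perPair_succ f g k)]
    exact (measurable_perStep hf hg).comp (ih.prodMk (measurable_pi_apply k))

/-- The probability that a perturbed arrival at time `s` comes later than `c`. -/
def lateProb (f g : α → ℝ) (ν : Measure α) (c s : ℝ) : ℝ := ν.real {x | c < s * g x / f x}

lemma monotone_lateProb (hf0 : ∀ x, 0 ≤ f x) (hg0 : ∀ x, 0 ≤ g x) (ν : Measure α)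
    [IsFiniteMeasure ν] (c : ℝ) : Monotone (lateProb f g ν c) := fun s t h =>
  measureReal_mono fun x (hx : c < s * g x / f x) => hx.trans_le <|
    div_le_div_of_nonneg_right (mul_le_mul_of_nonneg_right h (hg0 x)) (hf0 x)

/-- Weight of a state `(T, T*)` with `T ≤ t` and `T* > c`. -/
def perWeight (r c t : ℝ) (v : ℝ × EReal) : ℝ≥0∞ :=
  (if (c : EReal) < v.2 then 1 else 0) * if v.1 ≤ t then ENNReal.ofReal (Real.exp (r * v.1)) else 0

lemma measurable_perWeight (r c : ℝ) :
    Measurable fun p : (ℝ × EReal) × ℝ => perWeight r c p.2 p.1 := by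
  unfold perWeight
  refine (Measurable.ite (measurableSet_lt (by fun_prop) (by fun_prop)) (by fun_prop)
    (by fun_prop)).mul (Measurable.ite (measurableSet_le (by fun_prop) (by fun_prop)) (by fun_prop)
    (by fun_prop))

lemma measurable_perWeight_div (r M : ℝ) :
    Measurable fun p : (ℝ × EReal) × ℝ => perWeight r (p.2 / M) p.2 p.1 := by
  unfold perWeight
  refine (Measurable.ite (measurableSet_lt (by fun_prop) (by fun_prop)) (by fun_prop)
    (by fun_prop)).mul (Measurable.ite (measurableSet_le (by fun_prop) (by fun_prop)) (by fun_prop)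
    (by fun_prop))

/-- The weight `exp(r s)` of the new state cancels the `exp(-r s)` of the exponential density,
leaving the old weight at `s` times the rate `r` of late arrivals. -/
lemma lintegral_perWeight_perStep (hf : Measurable f) (hg : Measurable g) {ν : Measure α}
    [IsProbabilityMeasure ν] {r : ℝ} (hr : 0 < r) (c t : ℝ) (hlate : Measurable (lateProb f g ν c))
    (v : ℝ × EReal) :
    ∫⁻ z, perWeight r c t (perStep f g (v, z)) ∂((expMeasure r).prod ν)
      = ∫⁻ s, perWeight r c s v *
          (if s ≤ t then ENNReal.ofReal (r * lateProb f g ν c s) else 0) := by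
  have := isProbabilityMeasure_expMeasure hr
  have hm : Measurable fun z : ℝ × α => perWeight r c t (perStep f g (v, z)) :=
    (measurable_perWeight r c).comp
      (((measurable_perStep hf hg).comp measurable_prodMk_left).prodMk measurable_const)
  have hinner : ∀ e : ℝ, ∫⁻ x, perWeight r c t (perStep f g (v, (e, x))) ∂ν
      = (if (c : EReal) < v.2 then 1 else 0) * (ENNReal.ofReal (lateProb f g ν c (v.1 + e)) *
          if v.1 + e ≤ t then ENNReal.ofReal (Real.exp (r * (v.1 + e))) else 0) := fun e => by
    have hset : MeasurableSet {x | c < (v.1 + e) * g x / f x} :=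
      measurableSet_lt measurable_const (by fun_prop)
    have hp : ∀ x, perWeight r c t (perStep f g (v, (e, x)))
        = (if (c : EReal) < v.2 then 1 else 0) *
          ({x | c < (v.1 + e) * g x / f x}.indicator 1 x *
          if v.1 + e ≤ t then ENNReal.ofReal (Real.exp (r * (v.1 + e))) else 0) := fun x => by
      simp only [perWeight, perStep, lt_min_iff, EReal.coe_lt_coe_iff, indicator_apply,
        mem_ofPred_eq, Pi.one_apply]
      by_cases h1 : (c : EReal) < v.2 <;> by_cases h2 : c < (v.1 + e) * g x / f x <;>
        simp [h1, h2]
      congr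
    simp_rw [hp]
    rw [lintegral_const_mul _ ((measurable_one.indicator hset).mul_const _),
      lintegral_mul_const _ (measurable_one.indicator hset), lintegral_indicator_one hset,
      lateProb, ofReal_measureReal]
  have hh : Measurable fun s : ℝ => ENNReal.ofReal (lateProb f g ν c s) *
      if s ≤ t then ENNReal.ofReal (Real.exp (r * s)) else 0 :=
    hlate.ennreal_ofReal.mul (Measurable.ite measurableSet_Iic (by fun_prop) measurable_const)
  rw [lintegral_prod _ hm.aemeasurable]
  simp_rw [hinner]
  rw [lintegral_const_mul _ (f := fun e => ENNReal.ofReal (lateProb f g ν c (v.1 + e)) *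
      if v.1 + e ≤ t then ENNReal.ofReal (Real.exp (r * (v.1 + e))) else 0)
      (hh.comp (measurable_const_add v.1)),
    lintegral_expMeasure_add r v.1 hh, ← lintegral_const_mul']
  · refine lintegral_congr fun s => ?_
    rw [perWeight, mul_assoc]
    congr 2
    split_ifs
    · rw [mul_left_comm, ← ENNReal.ofReal_mul (by positivity), mul_assoc r, ← Real.exp_add,
        neg_add_cancel, Real.exp_zero, mul_one, mul_comm, ← ENNReal.ofReal_mul hr.le]
    · simp
  · split_ifs <;> simp

/-- The law of the state after `k` iterations, tested against `perWeight`. -/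
lemma lintegral_perWeight_eq (hf : Measurable f) (hg : Measurable g)
    (hf0 : ∀ x, 0 ≤ f x) (hg0 : ∀ x, 0 ≤ g x) {ν : Measure α}
    [IsProbabilityMeasure ν] {r : ℝ} (hr : 0 < r) {c : ℝ}
    {τ : ℕ → Measure (ℝ × EReal)} [∀ k, SFinite (τ k)] (h0 : τ 0 = Measure.dirac (0, ⊤))
    (hstep : ∀ k, τ (k + 1) = ((τ k).prod ((expMeasure r).prod ν)).map (perStep f g))
    (k : ℕ) (t : ℝ) :
    ∫⁻ v, perWeight r c t v ∂(τ k) = if 0 ≤ t then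
      ENNReal.ofReal (r ^ k * (∫ s in (0 : ℝ)..t, lateProb f g ν c s) ^ k / k.factorial) else 0 := by
  have := isProbabilityMeasure_expMeasure hr
  have hmono := monotone_lateProb hf0 hg0 ν c
  have hnn : ∀ s, 0 ≤ lateProb f g ν c s := fun s => measureReal_nonneg
  have hwm : ∀ t, Measurable (perWeight r c t) := fun t =>
    (measurable_perWeight r c).comp measurable_prodMk_right
  -- The threshold `c` stays fixed while `t` varies; only afterwards is `c` tied to `t` by `c = t /
  -- M`.
  induction k generalizing t with
  | zero =>
    rw [h0, lintegral_dirac' _ (hwm t)]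
    simp [perWeight]
  | succ k ih =>
    have hwt : Measurable fun s : ℝ => (if s ≤ t then ENNReal.ofReal (r * lateProb f g ν c s) else 0) :=
      Measurable.ite measurableSet_Iic (hmono.measurable.const_mul r).ennreal_ofReal measurable_const
    rw [hstep, lintegral_map (hwm t) (measurable_perStep hf hg),
      lintegral_prod (fun p => perWeight r c t (perStep f g p))
        ((hwm t).comp (measurable_perStep hf hg)).aemeasurable]
    simp_rw [lintegral_perWeight_perStep hf hg hr c t hmono.measurable]
    rw [lintegral_lintegral_swap
      ((measurable_perWeight r c).mul (hwt.comp measurable_snd)).aemeasurable]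
    simp_rw [fun s => lintegral_mul_const (μ := τ k)
      (if s ≤ t then ENNReal.ofReal (r * lateProb f g ν c s) else 0) (hwm s), ih]
    by_cases ht : 0 ≤ t
    · have hI : ∀ s, (if 0 ≤ s then ENNReal.ofReal (r ^ k *
          (∫ u in (0 : ℝ)..s, lateProb f g ν c u) ^ k / k.factorial) else 0) *
          (if s ≤ t then ENNReal.ofReal (r * lateProb f g ν c s) else 0)
          = (Icc 0 t).indicator (fun s => ENNReal.ofReal (r ^ (k + 1) / k.factorial) *
            ENNReal.ofReal (lateProb f g ν c s * (∫ u in (0 : ℝ)..s, lateProb f g ν c u) ^ k)) s :=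
        fun s => by
          by_cases h1 : 0 ≤ s
          · by_cases h2 : s ≤ t
            · rw [if_pos h1, if_pos h2, indicator_of_mem (show s ∈ Icc 0 t from ⟨h1, h2⟩),
                ← ENNReal.ofReal_mul', ← ENNReal.ofReal_mul (by positivity)]
              · congr 1
                ring
              · exact mul_nonneg hr.le (hnn s)
            · rw [if_neg h2, mul_zero, indicator_of_notMem fun h => h2 h.2]
          · rw [if_neg h1, zero_mul, indicator_of_notMem fun h => h1 h.1]
      simp_rw [hI]
      rw [lintegral_indicator measurableSet_Icc, lintegral_const_mul' _ _ ENNReal.ofReal_ne_top,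
        lintegral_monotone_mul_integral_pow hmono hnn k ht, if_pos ht,
        ← ENNReal.ofReal_mul (by positivity), Nat.factorial_succ]
      congr 1
      push_cast
      field_simp
    · rw [if_neg ht, lintegral_eq_zero_of_ae_eq_zero]
      refine ae_of_all _ fun s => ?_
      by_cases h1 : 0 ≤ s
      · simp [show ¬ s ≤ t from fun h => ht (h1.trans h)]
      · simp [h1]

lemma prod_next_lt_eq_lintegral {ν : Measure α} [IsProbabilityMeasure ν] {r M : ℝ} (hr : 0 < r)
    {τ : Measure (ℝ × EReal)} [SFinite τ] :
    (τ.prod ((expMeasure r).prod ν)) {p | (((p.1.1 + p.2.1) / M : ℝ) : EReal) < p.1.2}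
      = ∫⁻ s, (∫⁻ v, perWeight r (s / M) s v ∂τ) * ENNReal.ofReal (r * Real.exp (-(r * s))) := by
  have := isProbabilityMeasure_expMeasure hr
  have hset : MeasurableSet
      {p : (ℝ × EReal) × (ℝ × α) | (((p.1.1 + p.2.1) / M : ℝ) : EReal) < p.1.2} :=
    measurableSet_lt (by fun_prop) (by fun_prop)
  have hwm : ∀ s, Measurable (perWeight r (s / M) s) := fun s =>
    (measurable_perWeight_div r M).comp measurable_prodMk_right
  rw [Measure.prod_apply hset]
  have hinner : ∀ v : ℝ × EReal, ((expMeasure r).prod ν)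
      (Prod.mk v ⁻¹' {p | (((p.1.1 + p.2.1) / M : ℝ) : EReal) < p.1.2})
      = ∫⁻ s, perWeight r (s / M) s v * ENNReal.ofReal (r * Real.exp (-(r * s))) := fun v => by
    have hs : MeasurableSet {e : ℝ | (((v.1 + e) / M : ℝ) : EReal) < v.2} :=
      measurableSet_lt (by fun_prop) (by fun_prop)
    have hp : (Prod.mk v ⁻¹' {p : (ℝ × EReal) × (ℝ × α) |
        (((p.1.1 + p.2.1) / M : ℝ) : EReal) < p.1.2})
        = {e : ℝ | (((v.1 + e) / M : ℝ) : EReal) < v.2} ×ˢ univ := by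
      ext ⟨e, x⟩
      simp
    have hh : Measurable fun s : ℝ => if ((s / M : ℝ) : EReal) < v.2 then (1 : ℝ≥0∞) else 0 :=
      Measurable.ite (measurableSet_lt (by fun_prop) (by fun_prop)) (by fun_prop) (by fun_prop)
    rw [hp, Measure.prod_prod, measure_univ, mul_one, ← lintegral_indicator_one hs]
    refine (lintegral_congr fun e => ?_).trans ((lintegral_expMeasure_add r v.1 hh).trans
      (lintegral_congr fun s => ?_))
    · simp [indicator_apply]
    · rw [perWeight]
      ring
  simp_rw [hinner]
  rw [lintegral_lintegral_swap ((measurable_perWeight_div r M).mul (by fun_prop)).aemeasurable]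
  exact lintegral_congr fun s => lintegral_mul_const _ (hwm s)

/-- With `c = s / M` the weighted mass is `(r s q)^k / k!`; times `r exp(-r s)` it is `q^k` times
the Gamma density with shape `k + 1` and rate `r`. -/
lemma prob_next_lt (hf : Measurable f) (hg : Measurable g)
    (hf0 : ∀ x, 0 ≤ f x) (hg0 : ∀ x, 0 ≤ g x) {ν : Measure α}
    [IsProbabilityMeasure ν] {r M q : ℝ} (hr : 0 < r) (hq : 0 ≤ q)
    {τ : ℕ → Measure (ℝ × EReal)} [∀ k, SFinite (τ k)] (h0 : τ 0 = Measure.dirac (0, ⊤))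
    (hstep : ∀ k, τ (k + 1) = ((τ k).prod ((expMeasure r).prod ν)).map (perStep f g))
    (hlate : ∀ a : ℝ, 0 < a → ∫ s in (0 : ℝ)..a, lateProb f g ν (a / M) s = a * q) (k : ℕ) :
    ((τ k).prod ((expMeasure r).prod ν)) {p | (((p.1.1 + p.2.1) / M : ℝ) : EReal) < p.1.2}
      = ENNReal.ofReal (q ^ k) := by
  rw [prod_next_lt_eq_lintegral hr]
  have hk : (0 : ℝ) < (k : ℝ) + 1 := by positivity
  have hae : ∀ᵐ s : ℝ, (∫⁻ v, perWeight r (s / M) s v ∂(τ k)) *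
      ENNReal.ofReal (r * Real.exp (-(r * s)))
      = gammaPDF (k + 1) r s * ENNReal.ofReal (q ^ k) := by
    filter_upwards [Measure.ae_ne volume (0 : ℝ)] with s hs
    rw [lintegral_perWeight_eq hf hg hf0 hg0 hr h0 hstep]
    rcases hs.lt_or_gt with h | h
    · rw [if_neg h.not_ge, gammaPDF_of_neg h, zero_mul, zero_mul]
    · rw [if_pos h.le, gammaPDF_of_nonneg h.le, hlate s h, ← ENNReal.ofReal_mul (by positivity),
        ← ENNReal.ofReal_mul (by positivity), Real.Gamma_nat_eq_factorial, add_sub_cancel_right,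
        Real.rpow_natCast, ← Nat.cast_succ, Real.rpow_natCast, mul_pow, pow_succ]
      congr 1
      ring
  rw [lintegral_congr_ae hae, lintegral_mul_const', lintegral_gammaPDF_eq_one hk hr, one_mul]
  exact ENNReal.ofReal_ne_top

end
end

/-! ### Survival probabilities of the two algorithms -/

/-- By monotonicity of the arrival times and of `T*`, failing the last test implies failing all
earlier ones. -/
lemma lt_perCount_iff {α : Type*} {f g : α → ℝ} {M : ℝ} (hM : 0 < M) {y : ℕ → ℝ × α}
    (hy : ∀ i, 0 ≤ (y i).1) (k : ℕ) :
    ((k + 1 : ℕ) : ℕ∞) < perCount f g M y ↔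
      ((arrivalTime y (k + 2) / M : ℝ) : EReal) < (perState f g y (k + 1)).1 := by
  have hT : Monotone (arrivalTime y) := monotone_nat_of_le_succ fun n => by
    rw [arrivalTime_succ]
    exact le_add_of_nonneg_right (hy n)
  have hS : Antitone fun n => (perState f g y n).1 := antitone_nat_of_succ_le fun n => by
    rw [perState_succ_fst]
    exact min_le_left _ _
  rw [perCount, lt_iterationCount_iff]
  refine ⟨fun h => not_le.1 (h k k.lt_succ_self), fun h i hi => not_le.2 ?_⟩
  refine lt_of_le_of_lt (EReal.coe_le_coe_iff.2 ?_) (h.trans_le (hS (by omega : i + 1 ≤ k + 1)))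
  exact div_le_div_of_nonneg_right (hT (by omega)) hM.le

section

variable {α : Type*} [MeasurableSpace α] {f g : α → ℝ}

/-- By Fubini, for fixed `x` the late times in `(0, a]` form the interval from `a f(x) / (g(x) M)`
to `a`. -/
lemma integral_lateProb (hf : Measurable f) (hg : Measurable g) {ν : Measure α}
    [IsProbabilityMeasure ν] (hpos : ∀ᵐ x ∂ν, 0 < f x ∧ 0 < g x) {M : ℝ} (hM : 0 < M)
    (hle : ∀ᵐ x ∂ν, f x / (g x * M) ≤ 1) (hf0 : ∀ x, 0 ≤ f x) (hg0 : ∀ x, 0 ≤ g x)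
    {a : ℝ} (ha : 0 < a) :
    ∫ s in (0 : ℝ)..a, lateProb f g ν (a / M) s = a * (1 - ∫ x, f x / (g x * M) ∂ν) := by
  have hmono := monotone_lateProb hf0 hg0 ν (a / M)
  have hset : MeasurableSet {p : ℝ × α | a / M < p.1 * g p.2 / f p.2} :=
    measurableSet_lt measurable_const (by fun_prop)
  have hint : Integrable (fun x => f x / (g x * M)) ν := by
    refine Integrable.of_bound (by fun_prop : Measurable _).aestronglyMeasurable 1 ?_
    filter_upwards [hle] with x hx
    rwa [Real.norm_of_nonneg (div_nonneg (hf0 x) (mul_nonneg (hg0 x) hM.le))]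
  have hnn : 0 ≤ᵐ[ν] fun x => a * (1 - f x / (g x * M)) := by
    filter_upwards [hle] with x hx
    exact mul_nonneg ha.le (sub_nonneg.2 hx)
  have h1 : a * (1 - ∫ x, f x / (g x * M) ∂ν) = ∫ x, a * (1 - f x / (g x * M)) ∂ν := by
    rw [integral_const_mul, integral_sub (integrable_const _) hint]
    simp
  rw [h1, intervalIntegral.integral_of_le ha.le, integral_eq_lintegral_of_nonneg_ae
    (f := lateProb f g ν (a / M)) (ae_of_all _ fun s => measureReal_nonneg) hmono.measurable.aestronglyMeasurable,
    integral_eq_lintegral_of_nonneg_ae hnn (by fun_prop : Measurable _).aestronglyMeasurable]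
  congr 1
  have h2 : ∀ s, ENNReal.ofReal (lateProb f g ν (a / M) s)
      = ν (Prod.mk s ⁻¹' {p : ℝ × α | a / M < p.1 * g p.2 / f p.2}) := fun s =>
    ofReal_measureReal
  simp_rw [h2]
  rw [← Measure.prod_apply hset, Measure.prod_apply_symm hset]
  refine lintegral_congr_ae ?_
  filter_upwards [hpos] with x ⟨hx, hx'⟩
  have h3 : (fun s : ℝ => (s, x)) ⁻¹' {p : ℝ × α | a / M < p.1 * g p.2 / f p.2}
      = Ioi (a * (f x / (g x * M))) := by
    ext s
    simp only [mem_preimage, mem_ofPred_eq, mem_Ioi]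
    rw [← mul_div_assoc, div_lt_div_iff₀ hM hx, div_lt_iff₀ (by positivity), mul_assoc]
  have h4 : 0 ≤ a * (f x / (g x * M)) := by positivity
  have h5 : Ioi (a * (f x / (g x * M))) ∩ Ioc 0 a = Ioc (a * (f x / (g x * M))) a := by
    ext s
    simp only [mem_inter_iff, mem_Ioi, mem_Ioc]
    exact ⟨fun h => ⟨h.1, h.2.2⟩, fun h => ⟨h.1, h4.trans_lt h.1, h.2⟩⟩
  rw [h3, Measure.restrict_apply measurableSet_Ioi, h5, Real.volume_Ioc]
  congr 1
  ring

lemma measurable_arrivalTime (m : ℕ) : Measurable fun y : ℕ → ℝ × α => arrivalTime y m :=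
  Finset.measurable_fun_sum _ fun j _ => (measurable_pi_apply j).fst

lemma measurable_iterationCount {β : Type*} [MeasurableSpace β] {halt : β → ℕ → Prop}
    (h : ∀ i, MeasurableSet {b | halt b i}) : Measurable fun b => iterationCount (halt b) := by
  refine measurable_enat_of_lt fun k => ?_
  simp_rw [lt_iterationCount_iff]
  have : {b | ∀ i < k, ¬ halt b i} = ⋂ i < k, {b | halt b i}ᶜ := by
    ext b
    simp
  rw [this]
  exact MeasurableSet.biInter (to_countable _) fun i _ => (h i).compl

lemma measurable_perCount (hf : Measurable f) (hg : Measurable g) (M : ℝ) :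
    Measurable (perCount f g M) :=
  measurable_iterationCount fun i => measurableSet_le (measurable_perPair hf hg (i + 1)).snd
    ((measurable_arrivalTime (i + 2)).div_const M).coe_real_ereal

lemma measurable_rejCount (hf : Measurable f) (hg : Measurable g) (M : ℝ) :
    Measurable (rejCount f g M) :=
  measurable_iterationCount fun i => measurableSet_lt (measurable_pi_apply i).snd
    (by fun_prop)

lemma measure_lt_perCount (hf : Measurable f) (hg : Measurable g)
    (hf0 : ∀ x, 0 ≤ f x) (hg0 : ∀ x, 0 ≤ g x) {ν : Measure α} [IsProbabilityMeasure ν]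
    (hpos : ∀ᵐ x ∂ν, 0 < f x ∧ 0 < g x) {M : ℝ} (hM : 0 < M)
    (hle : ∀ᵐ x ∂ν, f x / (g x * M) ≤ 1) {r : ℝ} (hr : 0 < r)
    {Ω : Type*} [MeasurableSpace Ω] {Pr : Measure Ω} [IsProbabilityMeasure Pr]
    {Z : ℕ → Ω → ℝ × α} (hZ : IsIIDSeq Z ((expMeasure r).prod ν) Pr) {ρ : ℝ}
    (hρ : ∫ x, f x / (g x * M) ∂ν = ρ) (hρ1 : ρ ≤ 1) (k : ℕ) :
    Pr {ω | (k : ℕ∞) < perCount f g M fun i => Z i ω} = ENNReal.ofReal ((1 - ρ) ^ k) := by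
  have := isProbabilityMeasure_expMeasure hr
  have hZm : AEMeasurable (fun ω i => Z i ω) Pr :=
    aemeasurable_pi_lambda _ fun i => (hZ.1 i).aemeasurable
  rcases k with _ | k
  · have : {ω | ((0 : ℕ) : ℕ∞) < perCount f g M fun i => Z i ω} = univ :=
      eq_univ_of_forall fun ω => lt_iterationCount_iff.2 fun i hi => absurd hi i.not_lt_zero
    simp only [this, measure_univ, pow_zero, ENNReal.ofReal_one]
  let τ : ℕ → Measure (ℝ × EReal) := fun k => Pr.map fun ω => perPair f g k fun i => Z i ω
  have h0 : τ 0 = Measure.dirac (0, ⊤) := by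
    have : (fun ω => perPair f g 0 fun i => Z i ω) = fun _ => ((0 : ℝ), (⊤ : EReal)) := rfl
    simp only [τ, this, Measure.map_const, measure_univ, one_smul]
  have hstep : ∀ k, τ (k + 1) = ((τ k).prod ((expMeasure r).prod ν)).map (perStep f g) := fun k =>
    map_step_eq_map_prod hZ (measurable_perPair hf hg k) (dependsOn_perPair f g k)
      (measurable_perStep hf hg) (perPair_succ f g k)
  have key := prob_next_lt hf hg hf0 hg0 hr (sub_nonneg.2 hρ1) h0 hstep (M := M)
    (fun a ha => hρ ▸ integral_lateProb hf hg hpos hM hle hf0 hg0 ha) (k + 1)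
  have hΦ : Measurable fun p : (ℝ × EReal) × (ℝ × α) =>
      ((((p.1.1 + p.2.1) / M : ℝ) : EReal), p.1.2) := by fun_prop
  have hlt : MeasurableSet {p : EReal × EReal | p.1 < p.2} :=
    measurableSet_lt measurable_fst measurable_snd
  have hW : Measurable fun y : ℕ → ℝ × α =>
      (((arrivalTime y (k + 2) / M : ℝ) : EReal), (perState f g y (k + 1)).1) :=
    ((measurable_arrivalTime (k + 2)).div_const M).coe_real_ereal.prodMk
      (measurable_perPair hf hg (k + 1)).snd
  have hmap := map_step_eq_map_prod hZ (measurable_perPair hf hg (k + 1))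
    (dependsOn_perPair f g (k + 1)) hΦ (W := fun y =>
      (((arrivalTime y (k + 2) / M : ℝ) : EReal), (perState f g y (k + 1)).1))
    fun y => by rw [arrivalTime_succ]; rfl
  have hev := DFunLike.congr_fun hmap {p : EReal × EReal | p.1 < p.2}
  rw [Measure.map_apply hΦ hlt, Measure.map_apply_of_aemeasurable
    (f := fun ω => (((arrivalTime (fun i => Z i ω) (k + 2) / M : ℝ) : EReal),
      (perState f g (fun i => Z i ω) (k + 1)).1)) (hW.comp_aemeasurable hZm) hlt] at hev
  rw [← key]
  refine (measure_congr ?_).trans hev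
  -- Waiting times are nonnegative only almost surely, so the reduction to one test holds off a null
  -- set.
  have hE : ∀ᵐ z ∂((expMeasure r).prod ν), 0 ≤ z.1 := by
    have : ∀ᵐ e ∂(expMeasure r), 0 ≤ e := by
      have hexp : expMeasure r = volume.withDensity (exponentialPDF r) := rfl
      rw [hexp, ae_withDensity_iff (show Measurable (exponentialPDF r) from
        (measurable_exponentialPDFReal r).ennreal_ofReal)]
      refine ae_of_all _ fun e he => ?_
      contrapose! he
      exact exponentialPDF_of_neg he
    exact Measure.quasiMeasurePreserving_fst.ae this
  have hE' : ∀ᵐ ω ∂Pr, ∀ i, 0 ≤ (Z i ω).1 := ae_all_iff.2 fun i =>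
    ((hZ.1 i).ae_iff (measurableSet_setOfPred.1 (measurableSet_le measurable_const measurable_fst))).2 hE
  filter_upwards [hE'] with ω hω
  exact propext (lt_perCount_iff hM hω k)

lemma measure_lt_rejCount (hf : Measurable f) (hg : Measurable g)
    (hf0 : ∀ x, 0 ≤ f x) (hg0 : ∀ x, 0 ≤ g x) {ν : Measure α} [IsProbabilityMeasure ν]
    {M : ℝ} (hM : 0 < M) (hle : ∀ᵐ x ∂ν, f x / (g x * M) ≤ 1) {r : ℝ} (hr : 0 < r)
    {Ω : Type*} [MeasurableSpace Ω] {Pr : Measure Ω} [IsProbabilityMeasure Pr]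
    {Y : ℕ → Ω → (ℝ × α) × ℝ} (hY : IsIIDSeq Y (((expMeasure r).prod ν).prod uniform01) Pr) {ρ : ℝ}
    (hρ : ∫ x, f x / (g x * M) ∂ν = ρ) (hρ1 : ρ ≤ 1) (k : ℕ) :
    Pr {ω | (k : ℕ∞) < rejCount f g M fun i => Y i ω} = ENNReal.ofReal ((1 - ρ) ^ k) := by
  have := isProbabilityMeasure_expMeasure hr
  have : IsFiniteMeasure uniform01 := by unfold uniform01; infer_instance
  let A : Set ((ℝ × α) × ℝ) := {p | f p.1.2 / (g p.1.2 * M) ≤ p.2}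
  have hA : MeasurableSet A := measurableSet_le (by fun_prop) (by fun_prop)
  have hint : Integrable (fun x => f x / (g x * M)) ν := by
    refine Integrable.of_bound (by fun_prop : Measurable _).aestronglyMeasurable 1 ?_
    filter_upwards [hle] with x hx
    rwa [Real.norm_of_nonneg (div_nonneg (hf0 x) (mul_nonneg (hg0 x) hM.le))]
  have hPA : (((expMeasure r).prod ν).prod uniform01) A = ENNReal.ofReal (1 - ρ) := by
    have h1 : ∀ z : ℝ × α, uniform01 (Prod.mk z ⁻¹' A)
        = ENNReal.ofReal (1 - f z.2 / (g z.2 * M)) := fun z => by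
      have h2 : Prod.mk z ⁻¹' A = Ici (f z.2 / (g z.2 * M)) := rfl
      have h3 : Ici (f z.2 / (g z.2 * M)) ∩ Icc 0 1 = Icc (f z.2 / (g z.2 * M)) 1 := by
        ext u
        have : 0 ≤ f z.2 / (g z.2 * M) := div_nonneg (hf0 _) (mul_nonneg (hg0 _) hM.le)
        simp only [mem_inter_iff, mem_Ici, mem_Icc]
        exact ⟨fun h => ⟨h.1, h.2.2⟩, fun h => ⟨h.1, this.trans h.1, h.2⟩⟩
      rw [h2, uniform01, Measure.restrict_apply measurableSet_Ici, h3, Real.volume_Icc]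
    rw [Measure.prod_apply hA]
    simp_rw [h1]
    rw [lintegral_prod _ (by fun_prop)]
    simp only [lintegral_const, measure_univ, mul_one]
    rw [← ofReal_integral_eq_lintegral_ofReal (f := fun x => 1 - f x / (g x * M))
      ((integrable_const _).sub hint),
      integral_sub (integrable_const _) hint, hρ]
    · simp
    · filter_upwards [hle] with x hx
      exact sub_nonneg.2 hx
  have hset : {ω | (k : ℕ∞) < rejCount f g M fun i => Y i ω}
      = ⋂ i ∈ Finset.range k, Y i ⁻¹' A := by
    ext ω
    simp [rejCount, lt_iterationCount_iff, A]
  rw [hset, hY.2.measure_inter_preimage_eq_mul (Finset.range k) (sets := fun _ => A) fun _ _ => hA,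
    Finset.prod_congr rfl fun i _ => (show Pr (Y i ⁻¹' A) = ENNReal.ofReal (1 - ρ) by
      rw [← hPA, ← (hY.1 i).map_eq, Measure.map_apply_of_aemeasurable (hY.1 i).aemeasurable hA]),
    Finset.prod_const, Finset.card_range, ENNReal.ofReal_pow (sub_nonneg.2 hρ1)]
end

/-! ### Identification of the success probability and conclusion -/

lemma lintegral_ratio_withDensity {α : Type*} [MeasurableSpace α] {μ : Measure α} {f g : α → ℝ}
    (hf : Measurable f) (hg : Measurable g) (hg0 : ∀ x, 0 ≤ g x)
    (hsupp : Function.support f = Function.support g) {M : ℝ} (hM : 0 < M) :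
    ∫⁻ x, ENNReal.ofReal (f x / (g x * M)) ∂(μ.withDensity fun x => ENNReal.ofReal (g x))
      = (μ.withDensity fun x => ENNReal.ofReal (f x)) univ * ENNReal.ofReal M⁻¹ := by
  rw [lintegral_withDensity_eq_lintegral_mul _ hg.ennreal_ofReal (by fun_prop),
    withDensity_apply _ MeasurableSet.univ, Measure.restrict_univ,
    ← lintegral_mul_const _ hf.ennreal_ofReal]
  refine lintegral_congr fun x => ?_
  rw [Pi.mul_apply, ← ENNReal.ofReal_mul (hg0 x), ← ENNReal.ofReal_mul' (inv_nonneg.2 hM.le)]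
  congr 1
  by_cases hx : g x = 0
  · have : f x = 0 := Function.notMem_support.1 (hsupp ▸ Function.notMem_support.2 hx)
    simp [hx, this]
  · field_simp

/-- Scaling changes the rate but cancels in the location law, so both algorithms propose from the
same `ν`. -/
lemma raceStepLaw_smul {α : Type*} [MeasurableSpace α] (Q : Measure α) {M : ℝ} (hM : 0 < M) :
    raceStepLaw (ENNReal.ofReal M • Q)
      = (expMeasure (M * Q.real univ)).prod ((Q univ)⁻¹ • Q) := by
  have h0 : ENNReal.ofReal M ≠ 0 := (ENNReal.ofReal_pos.2 hM).ne'
  rw [raceStepLaw, measureReal_ennreal_smul_apply, ENNReal.toReal_ofReal hM.le, smul_smul,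
    Measure.smul_apply, smul_eq_mul,
    ENNReal.mul_inv (Or.inl h0) (Or.inl ENNReal.ofReal_ne_top), mul_right_comm,
    ENNReal.inv_mul_cancel h0 ENNReal.ofReal_ne_top, one_mul]

theorem mainTheorem6 {n : ℕ}
    (μ P Q : Measure (EuclideanSpace ℝ (Fin n))) [IsFiniteMeasure P] [IsFiniteMeasure Q]
    (hP0 : P ≠ 0) (hQ0 : Q ≠ 0)
    (f g : EuclideanSpace ℝ (Fin n) → ℝ) (hf : Measurable f) (hg : Measurable g)
    (hf0 : ∀ x, 0 ≤ f x) (hg0 : ∀ x, 0 ≤ g x)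
    (hP : P = μ.withDensity fun x => ENNReal.ofReal (f x))
    (hQ : Q = μ.withDensity fun x => ENNReal.ofReal (g x))
    (hsupp : Function.support f = Function.support g)
    (M : ℝ) (hM : ∀ x ∈ Function.support g, f x / g x ≤ M)
    -- the random inputs of rejection sampling: a simulated race with measure `M Q`, and
    -- independent uniform variables
    {Ω₁ : Type*} [MeasurableSpace Ω₁] (Pr₁ : Measure Ω₁) [IsProbabilityMeasure Pr₁]
    (Y : ℕ → Ω₁ → (ℝ × EuclideanSpace ℝ (Fin n)) × ℝ)
    (hY : IsIIDSeq Y ((raceStepLaw (ENNReal.ofReal M • Q)).prod uniform01) Pr₁)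
    -- the random inputs of perturbation sampling: a simulated race with measure `Q`
    {Ω₂ : Type*} [MeasurableSpace Ω₂] (Pr₂ : Measure Ω₂) [IsProbabilityMeasure Pr₂]
    (Z : ℕ → Ω₂ → ℝ × EuclideanSpace ℝ (Fin n))
    (hZ : IsIIDSeq Z (raceStepLaw Q) Pr₂)
    (KREJ : Ω₁ → ℕ∞) (hKREJ : KREJ = fun ω => rejCount f g M fun i => Y i ω)
    (KPER : Ω₂ → ℕ∞) (hKPER : KPER = fun ω => perCount f g M fun i => Z i ω)
    (ρ : ℝ) (hρ : ρ = P.real univ / (Q.real univ * M)) :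
    (∀ k : ℕ, Pr₁.real {ω | (k : ℕ∞) < KREJ ω} = (1 - ρ) ^ k) ∧
    (∀ k : ℕ, Pr₂.real {ω | (k : ℕ∞) < KPER ω} = (1 - ρ) ^ k) ∧
    (∃ h : ρ ∈ unitInterval, IsGeometric KREJ ⟨ρ, h⟩ Pr₁ ∧ IsGeometric KPER ⟨ρ, h⟩ Pr₂) ∧
    ∫⁻ ω, (KREJ ω : ℝ≥0∞) ∂Pr₁ = ENNReal.ofReal (1 / ρ) ∧
    ∫⁻ ω, (KPER ω : ℝ≥0∞) ∂Pr₂ = ENNReal.ofReal (1 / ρ) := by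
  have hQ1 : Q univ ≠ 0 := Measure.measure_univ_ne_zero.2 hQ0
  have hP1 : P univ ≠ 0 := Measure.measure_univ_ne_zero.2 hP0
  have hQr : 0 < Q.real univ := ENNReal.toReal_pos hQ1 (measure_ne_top _ _)
  have hPr : 0 < P.real univ := ENNReal.toReal_pos hP1 (measure_ne_top _ _)
  -- Otherwise the positive ratio `f / g` could not be bounded by `M` anywhere on the support,
  -- forcing `f = 0` and `P = 0`.
  have hMpos : 0 < M := by
    by_contra hM'
    refine hP0 ?_
    have hz : f = 0 := by
      rw [← Function.support_eq_empty_iff, eq_empty_iff_forall_notMem]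
      intro x hx
      have hgx : x ∈ Function.support g := hsupp ▸ hx
      exact hM' ((div_pos ((hf0 x).lt_of_ne' hx) ((hg0 x).lt_of_ne' hgx)).trans_le (hM x hgx))
    rw [hP, hz]
    simp
  set ν : Measure (EuclideanSpace ℝ (Fin n)) := (Q univ)⁻¹ • Q with hν
  have hνp : IsProbabilityMeasure ν := ⟨by
    rw [hν, Measure.smul_apply, smul_eq_mul, ENNReal.inv_mul_cancel hQ1 (measure_ne_top _ _)]⟩
  have hle : ∀ x, f x / (g x * M) ≤ 1 := fun x => by
    by_cases hx : g x = 0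
    · simp [hx]
    · rw [← div_div, div_le_one hMpos]
      exact hM x hx
  have hposQ : ∀ᵐ x ∂Q, 0 < f x ∧ 0 < g x := by
    rw [hQ, ae_withDensity_iff hg.ennreal_ofReal]
    refine ae_of_all _ fun x hx => ?_
    have hgx : 0 < g x := by
      contrapose! hx
      exact ENNReal.ofReal_of_nonpos hx
    have hfx : x ∈ Function.support f := hsupp ▸ hgx.ne'
    exact ⟨(hf0 x).lt_of_ne' hfx, hgx⟩
  have hpos : ∀ᵐ x ∂ν, 0 < f x ∧ 0 < g x := Measure.ae_smul_measure hposQ _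
  have hρint : ∫ x, f x / (g x * M) ∂ν = ρ := by
    rw [integral_eq_lintegral_of_nonneg_ae
      (ae_of_all _ fun x => div_nonneg (hf0 x) (mul_nonneg (hg0 x) hMpos.le))
      (by fun_prop : Measurable _).aestronglyMeasurable, hν, lintegral_smul_measure, smul_eq_mul]
    have h := lintegral_ratio_withDensity (μ := μ) hf hg hg0 hsupp hMpos
    rw [← hP, ← hQ] at h
    rw [h, ENNReal.toReal_mul, ENNReal.toReal_mul, ENNReal.toReal_inv,
      ENNReal.toReal_ofReal (inv_nonneg.2 hMpos.le), hρ, Measure.real, Measure.real]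
    field_simp
  have hρ0 : 0 < ρ := hρ ▸ div_pos hPr (mul_pos hQr hMpos)
  have hρ1 : ρ ≤ 1 := by
    rw [← hρint]
    refine (integral_mono_of_nonneg
      (ae_of_all _ fun x => div_nonneg (hf0 x) (mul_nonneg (hg0 x) hMpos.le))
      (integrable_const (1 : ℝ)) (ae_of_all _ hle)).trans ?_
    simp
  have hρI : ρ ∈ unitInterval := ⟨hρ0.le, hρ1⟩
  rw [raceStepLaw_smul Q hMpos] at hY
  have hsR : ∀ k : ℕ, Pr₁.real {ω | (k : ℕ∞) < KREJ ω} = (1 - ρ) ^ k := fun k => by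
    rw [hKREJ, measureReal_def, measure_lt_rejCount hf hg hf0 hg0 hMpos (ae_of_all _ hle)
      (mul_pos hMpos hQr) hY hρint hρ1, ENNReal.toReal_ofReal (pow_nonneg (sub_nonneg.2 hρ1) k)]
  have hsP : ∀ k : ℕ, Pr₂.real {ω | (k : ℕ∞) < KPER ω} = (1 - ρ) ^ k := fun k => by
    rw [hKPER, measureReal_def, measure_lt_perCount hf hg hf0 hg0 hpos hMpos (ae_of_all _ hle)
      hQr hZ hρint hρ1, ENNReal.toReal_ofReal (pow_nonneg (sub_nonneg.2 hρ1) k)]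
  have hmR : AEMeasurable KREJ Pr₁ := hKREJ ▸ (measurable_rejCount hf hg M).comp_aemeasurable
    (aemeasurable_pi_lambda _ fun i => (hY.1 i).aemeasurable)
  have hmP : AEMeasurable KPER Pr₂ := hKPER ▸ (measurable_perCount hf hg M).comp_aemeasurable
    (aemeasurable_pi_lambda _ fun i => (hZ.1 i).aemeasurable)
  obtain ⟨hR1, hR2⟩ := isGeometric_and_lintegral_of_survival hmR hρI hρ0 hsR
  obtain ⟨hP1, hP2⟩ := isGeometric_and_lintegral_of_survival hmP hρI hρ0 hsP
  exact ⟨hsR, hsP, ⟨hρI, hR1, hP1⟩, hR2, hP2⟩
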